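/- Let $\xi$ be a real random variable that is subgaussian, i.e. there is a constant $C$ with $\Lambda(s) := \ln \mathbb{E}\, e^{s\xi} \le C s^2$ for every $s \in \mathbb{R}$ (in particular $\Lambda$ is finite everywhere and $\mathbb{E}\xi = 0$). Suppose that $\mathbb{E}\,\xi^3 < 0$ and $\lim_{s \to +\infty} \Lambda(s)/s^2 = 0$. Then there exists $\eta > 0$, depending only on the distribution of $\xi$, such that the following holds. For each $n$ let $A_n$ be a random real symmetric $n \times n$ matrix with zero diagonal whose entries above the diagonal are independent copies of $\xi$, and let $\lambda_1(A_n)$ be its largest eigenvalue. Let $(m_n)$ be any sequence of real numbers with $\sqrt n \ll m_n \ll n$, i.e. $m_n/\sqrt n \to +\infty$ and $m_n/n \to 0$. Then for every $t > 0$ the probability $\Pr(\lambda_1(A_n) > m_n t)$ is positive for all sufficiently large $n$, the limit below exists in $\mathbb{R}$, and $$\lim_{n \to \infty} \frac{1}{m_n^2} \ln \Pr\bigl(\lambda_1(A_n) > m_n t\bigr) > -(1-\eta)\, \frac{t^2}{4\,\mathbb{E}\,\xi^2}.$$ -/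

import Mathlib

open MeasureTheory ProbabilityTheory Filter Topology

/-- `A` is a random real symmetric `n × n` matrix with zero diagonal whose entries strictly above
the diagonal are independent copies of the random variable `ξ`. -/
structure IsSymmRandomMatrix {Ω₀ : Type*} [MeasurableSpace Ω₀] (P₀ : Measure Ω₀) (ξ : Ω₀ → ℝ)
    {n : ℕ} {Ω : Type*} [MeasurableSpace Ω] (P : Measure Ω)
    (A : Ω → Matrix (Fin n) (Fin n) ℝ) : Prop where
  symm : ∀ ω, (A ω).IsSymm
  diag_zero : ∀ ω i, A ω i i = 0
  indep : iIndepFun (fun (p : {p : Fin n × Fin n // p.1 < p.2}) (ω : Ω) => A ω p.1.1 p.1.2) P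
  identDistrib : ∀ i j : Fin n, i < j → IdentDistrib (fun ω => A ω i j) ξ P P₀

/-- The largest eigenvalue `λ₁(A)` of a real symmetric matrix (the spectrum is the finite set of
its eigenvalues, nonempty as soon as `1 ≤ n`). -/
noncomputable def lambdaOne {n : ℕ} (A : Matrix (Fin n) (Fin n) ℝ) : ℝ :=
  sSup (spectrum ℝ A)

/-! For a fixed vector `w`, independence makes the log-mgf of `w ⬝ᵥ A *ᵥ w` at 1 equal to `pairSum Λ
w`, with `Λ` the cgf of `ξ`. Let `F` be the supremum of `pairSum Λ w / ‖w‖⁴` over all nonzero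
vectors of all dimensions. The limit is `-t² / (4F)`, so everything rests on `F > σ²`, where `σ² = 𝔼
ξ²` (`exists_optimal_constant`). The negative third moment lifts `Λ` above the parabola `σ²s²/2` at
some negative point, and a vector with one large positive and many small negative coordinates
exploits this (`exists_lt_pairSum`).

Upper bound: Chernoff with constant `F` at each point of a net of the sphere
(`measureReal_lt_lambdaOne_le`). The net costs `O(n)` in the exponent, negligible against `m²` since
`m ≫ √n`.

Lower bound: a near-optimal `w` is replicated about `m` times, which fits in dimension `n` since `m
≪ n`. The resulting quadratic form nearly attains the Gaussian mgf bound, so a tilting argument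
gives the matching tail (`le_measureReal_lt_lambdaOne`). -/

/-! ### Taylor lower bounds for the exponential and the cgf. -/

theorem cubic_le_exp (x : ℝ) : 1 + x + x ^ 2 / 2 + x ^ 3 / 6 ≤ Real.exp x := by
  let f : ℝ → ℝ := fun x => Real.exp x - (1 + x + x ^ 2 / 2 + x ^ 3 / 6)
  let g : ℝ → ℝ := fun x => Real.exp x - (1 + x + x ^ 2 / 2)
  have hf : ∀ x, HasDerivAt f (g x) x := by
    intro x
    have := (Real.hasDerivAt_exp x).sub ((((hasDerivAt_id x).const_add 1).add
      ((hasDerivAt_pow 2 x).div_const 2)).add ((hasDerivAt_pow 3 x).div_const 6))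
    refine this.congr_deriv ?_
    simp [g]; ring
  have hg : ∀ x, HasDerivAt g (Real.exp x - (1 + x)) x := by
    intro x
    have := (Real.hasDerivAt_exp x).sub (((hasDerivAt_id x).const_add 1).add
      ((hasDerivAt_pow 2 x).div_const 2))
    refine this.congr_deriv ?_
    simp
  -- Since `f' = g` and `g` has the sign of its argument, `f` is minimal at 0.
  have hgm : Monotone g := monotone_of_deriv_nonneg (fun x => (hg x).differentiableAt) fun x => by
    rw [(hg x).deriv]; linarith [Real.add_one_le_exp x]
  have hg0 : g 0 = 0 := by simp [g]
  have hf0 : f 0 = 0 := by simp [f]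
  have hfc : Continuous f := continuous_iff_continuousAt.2 fun x => (hf x).continuousAt
  suffices 0 ≤ f x by simp only [f] at this; linarith
  rcases le_total 0 x with h | h
  · have : MonotoneOn f (Set.Ici 0) := monotoneOn_of_deriv_nonneg (convex_Ici 0) hfc.continuousOn
      (fun x _ => (hf x).differentiableAt.differentiableWithinAt) fun y hy => by
        rw [(hf y).deriv]; rw [interior_Ici] at hy
        have := hgm (le_of_lt hy : (0:ℝ) ≤ y); linarith
    have := this (Set.mem_Ici.2 le_rfl) h h; linarith
  · have : AntitoneOn f (Set.Iic 0) := antitoneOn_of_deriv_nonpos (convex_Iic 0) hfc.continuousOn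
      (fun x _ => (hf x).differentiableAt.differentiableWithinAt) fun y hy => by
        rw [(hf y).deriv]; rw [interior_Iic] at hy
        have := hgm (le_of_lt hy : y ≤ (0:ℝ)); linarith
    have := this h (Set.mem_Iic.2 le_rfl) h; linarith

namespace ProbabilityTheory.HasSubgaussianMGF

variable {Ω₀ : Type*} [MeasurableSpace Ω₀] {P₀ : Measure Ω₀} {ξ : Ω₀ → ℝ} {c : NNReal}

theorem integrable_pow (h : HasSubgaussianMGF ξ c P₀) (k : ℕ) :
    Integrable (fun ω => ξ ω ^ k) P₀ := by
  rcases Nat.eq_zero_or_pos k with rfl | hk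
  · have := h.integrable_exp_mul 0
    simpa using this
  have h1 := (h.memLp (k : NNReal)).integrable_norm_pow (by omega)
  refine (integrable_norm_iff (h.aestronglyMeasurable.pow k)).1 ?_
  simpa using h1

variable [IsProbabilityMeasure P₀]

theorem one_add_le_mgf (h : HasSubgaussianMGF ξ c P₀) (s : ℝ) :
    1 + s * ∫ ω, ξ ω ∂P₀ ≤ mgf ξ P₀ s := by
  have : ∫ ω, (1 + s * ξ ω) ∂P₀ ≤ mgf ξ P₀ s := by
    refine integral_mono ((integrable_const 1).add (h.integrable.const_mul s))
      (h.integrable_exp_mul s) fun ω => ?_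
    simpa [add_comm] using Real.add_one_le_exp (s * ξ ω)
  rwa [integral_add (integrable_const 1) (h.integrable.const_mul s), integral_const_mul,
    integral_const, probReal_univ, one_smul] at this

/-- The line `1 + s * μ` lies below `exp (c s² / 2)` and meets it at `s = 0`, where the latter has
derivative 0; hence the line is flat. -/
theorem integral_eq_zero (h : HasSubgaussianMGF ξ c P₀) :
    ∫ ω, ξ ω ∂P₀ = 0 := by
  set μ := ∫ ω, ξ ω ∂P₀
  by_contra hμ
  have hle : ∀ s : ℝ, 1 + s * μ ≤ Real.exp (c * s ^ 2 / 2) := fun s =>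
    (h.one_add_le_mgf s).trans (h.mgf_le s)
  let f : ℝ → ℝ := fun s => Real.exp (c * s ^ 2 / 2) - (1 + s * μ)
  have hd : HasDerivAt f (-μ) 0 := by
    have h1 : HasDerivAt (fun s : ℝ => (c : ℝ) * s ^ 2 / 2) 0 0 := by
      simpa using ((hasDerivAt_pow 2 (0 : ℝ)).const_mul (c : ℝ)).div_const 2
    have h2 := h1.exp.sub (((hasDerivAt_id (0 : ℝ)).mul_const μ).const_add 1)
    refine (h2.congr_deriv (by simp))
  have hmin : IsLocalMin f 0 := Filter.Eventually.of_forall fun s => by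
    simp only [f]; have := hle s; simp; linarith
  exact hμ (neg_eq_zero.1 (hmin.hasDerivAt_eq_zero hd))

theorem cgf_nonneg (h : HasSubgaussianMGF ξ c P₀) (s : ℝ) :
    0 ≤ cgf ξ P₀ s := by
  have := h.one_add_le_mgf s
  rw [h.integral_eq_zero] at this
  exact Real.log_nonneg (by linarith)

theorem cubic_le_mgf (h : HasSubgaussianMGF ξ c P₀) (s : ℝ) :
    1 + s ^ 2 / 2 * ∫ ω, ξ ω ^ 2 ∂P₀ + s ^ 3 / 6 * ∫ ω, ξ ω ^ 3 ∂P₀ ≤ mgf ξ P₀ s := by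
  have i1 := h.integrable.const_mul s
  have i2 := (h.integrable_pow 2).const_mul (s ^ 2 / 2)
  have i3 := (h.integrable_pow 3).const_mul (s ^ 3 / 6)
  have i01 : Integrable (fun ω => 1 + s * ξ ω) P₀ := (integrable_const (μ := P₀) (1 : ℝ)).add i1
  have i012 : Integrable (fun ω => 1 + s * ξ ω + s ^ 2 / 2 * ξ ω ^ 2) P₀ := i01.add i2
  have : ∫ ω, (1 + s * ξ ω + s ^ 2 / 2 * ξ ω ^ 2 + s ^ 3 / 6 * ξ ω ^ 3) ∂P₀ ≤ mgf ξ P₀ s := by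
    refine integral_mono (i012.add i3) (h.integrable_exp_mul s) fun ω => ?_
    have := cubic_le_exp (s * ξ ω)
    simp only
    linarith
  rw [integral_add i012 i3, integral_add i01 i2, integral_add (integrable_const 1) i1] at this
  simp only [integral_const_mul, h.integral_eq_zero, integral_const,
    probReal_univ] at this
  simpa using this

/-- Near the origin the cumulant generating function is bounded below by its third order Taylor
polynomial, up to a term of order four. -/
theorem cubic_le_cgf (h : HasSubgaussianMGF ξ c P₀) {s : ℝ} (hs : |s| ≤ 1) :
    s ^ 2 / 2 * (∫ ω, ξ ω ^ 2 ∂P₀) + s ^ 3 / 6 * (∫ ω, ξ ω ^ 3 ∂P₀)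
      - (|∫ ω, ξ ω ^ 2 ∂P₀| + |∫ ω, ξ ω ^ 3 ∂P₀|) ^ 2 * s ^ 4 ≤ cgf ξ P₀ s := by
  set a := ∫ ω, ξ ω ^ 2 ∂P₀
  set b := ∫ ω, ξ ω ^ 3 ∂P₀
  have h1 := h.cubic_le_mgf s
  have hM : 1 ≤ mgf ξ P₀ s := by
    have := h.one_add_le_mgf s
    rw [h.integral_eq_zero] at this
    linarith
  have hx : ∃ x, x = s ^ 2 / 2 * a + s ^ 3 / 6 * b := ⟨_, rfl⟩
  obtain ⟨x, hx⟩ := hx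
  have hx2 : x ^ 2 ≤ (|a| + |b|) ^ 2 * s ^ 4 := by
    have : |x| ≤ (|a| + |b|) * s ^ 2 := by
      rw [hx]
      refine (abs_add_le _ _).trans ?_
      rw [abs_mul, abs_mul, abs_div, abs_div, abs_pow, abs_pow]
      have e : s ^ 2 = |s| ^ 2 := (sq_abs s).symm
      rw [e]
      have h3 : |s| ^ 3 ≤ |s| ^ 2 := pow_le_pow_of_le_one (abs_nonneg s) hs (by norm_num)
      have ha := abs_nonneg a
      have hb := abs_nonneg b
      have hs2 : 0 ≤ |s| ^ 2 := by positivity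
      norm_num
      nlinarith [mul_nonneg hs2 ha, mul_nonneg hs2 hb, mul_le_mul_of_nonneg_right h3 hb]
    calc x ^ 2 = |x| ^ 2 := (sq_abs x).symm
      _ ≤ ((|a| + |b|) * s ^ 2) ^ 2 := by gcongr
      _ = _ := by ring
  -- For `x ≤ 0`, nonnegativity of the cgf suffices; for `x ≥ 0`, `log (1 + x) ≥ x / (1 + x) ≥ x -
  -- x²`.
  have key : x - x ^ 2 ≤ Real.log (mgf ξ P₀ s) := by
    rcases le_total x 0 with h0 | h0
    · have := Real.log_nonneg hM; nlinarith [sq_nonneg x]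
    · have h2 := Real.one_sub_inv_le_log_of_pos (x := 1 + x) (by linarith)
      have h3 : Real.log (1 + x) ≤ Real.log (mgf ξ P₀ s) :=
        Real.log_le_log (by linarith) (by linarith)
      have h4 : x - x ^ 2 ≤ 1 - (1 + x)⁻¹ := by
        have : 1 - (1 + x)⁻¹ = x / (1 + x) := by field_simp; ring
        rw [this, le_div_iff₀ (by linarith)]
        nlinarith [pow_nonneg h0 3]
      linarith
  rw [cgf]
  linarith

end ProbabilityTheory.HasSubgaussianMGF

/-! ### The variational problem for the optimal constant. -/

/-- The sum of `Λ (2 wᵢ wⱼ)` over unordered pairs of distinct indices. -/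
noncomputable def pairSum (Λ : ℝ → ℝ) {ι : Type*} [Fintype ι] (w : ι → ℝ) : ℝ :=
  ((∑ i, ∑ j, Λ (2 * (w i * w j))) - ∑ i, Λ (2 * (w i * w i))) / 2

theorem sum_sum_eq_two_mul_sum_lt {n : ℕ} {f : Fin n → Fin n → ℝ} (hf : ∀ i j, f i j = f j i) :
    ∑ i, ∑ j, f i j
      = 2 * ∑ p : {p : Fin n × Fin n // p.1 < p.2}, f p.1.1 p.1.2 + ∑ i, f i i := by
  have h1 : ∑ p : {p : Fin n × Fin n // p.1 < p.2}, f p.1.1 p.1.2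
      = ∑ i, ∑ j, if i < j then f i j else 0 := by
    rw [← Finset.sum_subtype (Finset.univ.filter fun p : Fin n × Fin n => p.1 < p.2) (by simp)
      (fun p => f p.1 p.2), Finset.sum_filter, ← Finset.univ_product_univ, Finset.sum_product]
  have h2 : ∑ i, ∑ j, (if i < j then f i j else 0) = ∑ i, ∑ j, if j < i then f i j else 0 := by
    rw [Finset.sum_comm]
    refine Finset.sum_congr rfl fun i _ => Finset.sum_congr rfl fun j _ => ?_
    rw [hf j]
  have h3 : ∑ i, f i i = ∑ i, ∑ j, if i = j then f i j else 0 := by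
    simp
  have h4 : ∑ i, ∑ j, f i j = (∑ i, ∑ j, if i < j then f i j else 0)
      + (∑ i, ∑ j, if j < i then f i j else 0) + ∑ i, ∑ j, if i = j then f i j else 0 := by
    simp only [← Finset.sum_add_distrib]
    refine Finset.sum_congr rfl fun i _ => Finset.sum_congr rfl fun j _ => ?_
    rcases lt_trichotomy i j with h | h | h
    · simp [h, h.not_gt, h.ne]
    · simp [h]
    · simp [h, h.not_gt, h.ne']
  rw [h1, h4, h3, ← h2]
  ring

theorem pairSum_eq_sum_lt (Λ : ℝ → ℝ) {n : ℕ} (w : Fin n → ℝ) :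
    pairSum Λ w = ∑ p : {p : Fin n × Fin n // p.1 < p.2}, Λ (2 * (w p.1.1 * w p.1.2)) := by
  rw [pairSum, sum_sum_eq_two_mul_sum_lt fun i j => by rw [mul_comm (w i)]]
  ring

/-- Only a nonnegative dilation can be absorbed into the vector, so the sharp constant controls the
mgf of the quadratic form only for `s ≥ 0`; negative `s` is left to the crude subgaussian bound. -/
theorem pairSum_mul (Λ : ℝ → ℝ) {ι : Type*} [Fintype ι] (w : ι → ℝ) {s : ℝ} (hs : 0 ≤ s) :
    pairSum (fun x => Λ (s * x)) w = pairSum Λ (fun i => √s * w i) := by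
  have h : ∀ i j, 2 * (√s * w i * (√s * w j)) = s * (2 * (w i * w j)) := fun i j => by
    linear_combination (2 * (w i * w j)) * Real.mul_self_sqrt hs
  simp only [pairSum, h]

theorem pairSum_le {Λ : ℝ → ℝ} {c : ℝ} (hnn : ∀ s, 0 ≤ Λ s) (hle : ∀ s, Λ s ≤ c * s ^ 2 / 2)
    {ι : Type*} [Fintype ι] (w : ι → ℝ) : pairSum Λ w ≤ c * (∑ i, w i ^ 2) ^ 2 := by
  have h1 : ∑ i, ∑ j, Λ (2 * (w i * w j)) ≤ ∑ i, ∑ j, 2 * c * (w i ^ 2 * w j ^ 2) :=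
    Finset.sum_le_sum fun i _ => Finset.sum_le_sum fun j _ => (hle _).trans (by nlinarith)
  have h2 : ∑ i, ∑ j, 2 * c * (w i ^ 2 * w j ^ 2) = 2 * c * (∑ i, w i ^ 2) ^ 2 := by
    simp_rw [← Finset.mul_sum]
    rw [← Finset.sum_mul, sq]
  have h3 : 0 ≤ ∑ i, Λ (2 * (w i * w i)) := Finset.sum_nonneg fun i _ => hnn _
  rw [pairSum]
  linarith

/-- Repeating every coordinate `L` times and padding with zeros. -/
theorem exists_replicate {Λ : ℝ → ℝ} (h0 : Λ 0 = 0) (hnn : ∀ s, 0 ≤ Λ s) {k L n : ℕ}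
    (w : Fin k → ℝ) (hn : k * L ≤ n) :
    ∃ u : Fin n → ℝ, ∑ i, u i ^ 2 = L * ∑ i, w i ^ 2 ∧ (L : ℝ) ^ 2 * pairSum Λ w ≤ pairSum Λ u := by
  obtain ⟨r, rfl⟩ := Nat.exists_eq_add_of_le hn
  let u : Fin (k * L + r) → ℝ := Fin.append (fun j => w (finProdFinEquiv.symm j).1) (fun _ => 0)
  have hsum : ∀ h : ℝ → ℝ, h 0 = 0 → ∑ j, h (u j) = L * ∑ i, h (w i) := by
    intro h hh
    rw [Fin.sum_univ_add]
    simp only [u, Fin.append_left, Fin.append_right, hh, Finset.sum_const_zero, add_zero]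
    rw [← finProdFinEquiv.sum_comp, Fintype.sum_prod_type]
    simp [Finset.mul_sum]
  refine ⟨u, hsum (fun x => x ^ 2) (by simp), ?_⟩
  have e1 : ∑ i, ∑ j, Λ (2 * (u i * u j)) = L * ∑ i, L * ∑ j, Λ (2 * (w i * w j)) := by
    have := hsum (fun x => ∑ j, Λ (2 * (x * u j))) (by simp [h0])
    rw [this]
    congr 1
    exact Finset.sum_congr rfl fun i _ => hsum (fun y => Λ (2 * (w i * y))) (by simp [h0])
  have e2 := hsum (fun x => Λ (2 * (x * x))) (by simp [h0])
  have hd : 0 ≤ ∑ i, Λ (2 * (w i * w i)) := Finset.sum_nonneg fun i _ => hnn _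
  -- Pairs of distinct copies of one coordinate contribute `(L² - L) / 2 * Λ (2 wᵢ²) ≥ 0`, which is
  -- discarded.
  have hL : (L : ℝ) ≤ L ^ 2 := by exact_mod_cast Nat.le_self_pow two_ne_zero L
  rw [pairSum, pairSum, e1, e2, ← Finset.mul_sum]
  nlinarith [mul_le_mul_of_nonneg_right hL hd]

/-- If `Λ` is strictly above the parabola `σ² s² / 2` at some negative point and asymptotically
above it near `0⁺`, then some vector beats the Gaussian value `σ² ‖w‖⁴`. -/
theorem exists_lt_pairSum {Λ : ℝ → ℝ} {σ2 s : ℝ} (hσ : 0 < σ2) (hs : 0 < s)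
    (hneg : σ2 * s ^ 2 / 2 < Λ (-s))
    (hloc : ∀ ε > 0, ∀ᶠ y in 𝓝[>] (0 : ℝ), (σ2 - ε) * y ^ 2 / 2 ≤ Λ y) :
    ∃ (k : ℕ) (w : Fin k → ℝ), 0 < ∑ i, w i ^ 2 ∧ σ2 * (∑ i, w i ^ 2) ^ 2 < pairSum Λ w := by
  obtain ⟨γ, hγ⟩ : ∃ γ, Λ (-s) = (σ2 + γ) * s ^ 2 / 2 :=
    ⟨2 * Λ (-s) / s ^ 2 - σ2, by field_simp; ring⟩
  have hγ0 : 0 < γ := by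
    rw [hγ] at hneg
    have h2 : 0 < s ^ 2 := by positivity
    nlinarith
  -- `r` will be the ratio of the squared length of the large coordinate to that of the `N` small
  -- ones. To leading order in `N` the gain over the Gaussian value is `N (γ s² / 2 - σ2 r s² / 4)`,
  -- positive for `r < 2γ / σ2`; the midpoint is taken. The local error `r * γ / 2` then consumes
  -- half of the gain.
  obtain ⟨r, hr⟩ : ∃ r, r = γ / σ2 := ⟨_, rfl⟩
  have hr0 : 0 < r := by rw [hr]; positivity
  have hrγ : σ2 * r = γ := by rw [hr]; field_simp
  have hy : Tendsto (fun N : ℕ => s / √(r * N)) atTop (𝓝[>] 0) := by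
    refine tendsto_nhdsWithin_iff.2 ⟨?_, ?_⟩
    · refine Tendsto.div_atTop tendsto_const_nhds ?_
      exact Real.tendsto_sqrt_atTop.comp (tendsto_natCast_atTop_atTop.const_mul_atTop hr0)
    · filter_upwards [eventually_gt_atTop 0] with N hN
      have : (0 : ℝ) < N := by exact_mod_cast hN
      exact div_pos hs (Real.sqrt_pos.2 (by positivity))
  have hlim : Tendsto (fun N : ℕ => Λ (-s) + (1 - (N : ℝ)⁻¹) * ((σ2 - r * γ / 2) * s ^ 2 / (4 * r)))
      atTop (𝓝 (Λ (-s) + (1 - 0) * ((σ2 - r * γ / 2) * s ^ 2 / (4 * r)))) :=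
    ((tendsto_inv_atTop_nhds_zero_nat.const_sub 1).mul_const _).const_add _
  have hgap : σ2 * (s ^ 2 / 4 * (1 / r + 2 + r))
      < Λ (-s) + (1 - 0) * ((σ2 - r * γ / 2) * s ^ 2 / (4 * r)) := by
    have e : Λ (-s) + (1 - 0) * ((σ2 - r * γ / 2) * s ^ 2 / (4 * r))
        - σ2 * (s ^ 2 / 4 * (1 / r + 2 + r)) = γ * s ^ 2 / 8 := by
      rw [hγ, ← hrγ]; field_simp; ring
    have : 0 < γ * s ^ 2 / 8 := by positivity
    linarith
  obtain ⟨N, hN1, hN2, hN0⟩ := ((hy.eventually (hloc (r * γ / 2) (by positivity))).and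
    ((hlim.eventually_const_lt hgap).and (eventually_ge_atTop 1))).exists
  have hNp : (1 : ℝ) ≤ N := by exact_mod_cast hN0
  set y := s / √(r * N) with hydef
  have hypos : 0 < y := div_pos hs (Real.sqrt_pos.2 (by positivity))
  have hy2 : y ^ 2 = s ^ 2 / (r * N) := by
    rw [hydef, div_pow, Real.sq_sqrt (by positivity)]
  have hb2 : √(y / 2) ^ 2 = y / 2 := Real.sq_sqrt (by positivity)
  have hb : 0 < √(y / 2) := Real.sqrt_pos.2 (by positivity)
  set b := √(y / 2)
  -- The `N` mixed pairs evaluate `Λ` at `-s`, the remaining pairs at `2b² = y`.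
  let w : Fin (N + 1) → ℝ := Fin.cons (s / (2 * b)) (fun _ => -b)
  have hw2 : ∑ i, w i ^ 2 = s ^ 2 / (2 * y) + N * (y / 2) := by
    simp [w, Fin.sum_univ_succ, hb2, div_pow, mul_pow]
    ring
  have hw4 : (∑ i, w i ^ 2) ^ 2 = N * (s ^ 2 / 4 * (1 / r + 2 + r)) := by
    have : (∑ i, w i ^ 2) ^ 2 = s ^ 4 / (4 * y ^ 2) + N * s ^ 2 / 2 + N ^ 2 * y ^ 2 / 4 := by
      rw [hw2]; field_simp; ring
    rw [this, hy2]; field_simp; ring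
  have hQ : pairSum Λ w = N * Λ (-s) + N * (N - 1) / 2 * Λ y := by
    have e1 : 2 * (b * (s / (2 * b))) = s := by field_simp
    have e2 : 2 * (s / (2 * b) * b) = s := by field_simp
    have e3 : 2 * (b * b) = y := by linarith [hb2]
    simp [pairSum, w, Fin.sum_univ_succ, e1, e2, e3]
    ring
  refine ⟨N + 1, w, by rw [hw2]; positivity, ?_⟩
  rw [hw4, hQ]
  have h5 : (σ2 - r * γ / 2) * y ^ 2 / 2 * (N * (N - 1) / 2) ≤ Λ y * (N * (N - 1) / 2) :=
    mul_le_mul_of_nonneg_right hN1 (by nlinarith)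
  have h6 : (σ2 - r * γ / 2) * y ^ 2 / 2 * (N * (N - 1) / 2)
      = N * ((1 - (N : ℝ)⁻¹) * ((σ2 - r * γ / 2) * s ^ 2 / (4 * r))) := by
    rw [hy2]; field_simp; ring
  have h7 := mul_lt_mul_of_pos_left hN2 (by linarith : (0 : ℝ) < N)
  linarith

/-- `F` is a supremum over all dimensions at once, finite by the subgaussian bound. As `b < 0`, the
cubic term is positive at small negative arguments, which gives the strict gap over `σ2`. -/
theorem exists_optimal_constant {Λ : ℝ → ℝ} {c σ2 b C : ℝ} (hnn : ∀ s, 0 ≤ Λ s)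
    (hle : ∀ s, Λ s ≤ c * s ^ 2 / 2) (hσ : 0 < σ2) (hb : b < 0)
    (hcubic : ∀ s, |s| ≤ 1 → s ^ 2 / 2 * σ2 + s ^ 3 / 6 * b - C * s ^ 4 ≤ Λ s) :
    ∃ F : ℝ, σ2 < F ∧ F ≤ c ∧ (∀ (n : ℕ) (w : Fin n → ℝ), pairSum Λ w ≤ F * (∑ i, w i ^ 2) ^ 2) ∧
      ∀ ε > 0, ∃ (k : ℕ) (w : Fin k → ℝ), 0 < ∑ i, w i ^ 2 ∧
        (F - ε) * (∑ i, w i ^ 2) ^ 2 ≤ pairSum Λ w := by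
  have h0 : Λ 0 = 0 := le_antisymm (by simpa using hle 0) (hnn 0)
  have hloc : ∀ ε > 0, ∀ᶠ y in 𝓝[>] (0 : ℝ), (σ2 - ε) * y ^ 2 / 2 ≤ Λ y := by
    intro ε hε
    have hc : Tendsto (fun y : ℝ => y / 6 * b - C * y ^ 2) (𝓝[>] 0) (𝓝 (0 / 6 * b - C * 0 ^ 2)) :=
      (Continuous.tendsto (by fun_prop) _).mono_left nhdsWithin_le_nhds
    have hlt : -ε / 2 < 0 / 6 * b - C * 0 ^ 2 := by simp; linarith
    filter_upwards [hc.eventually_const_lt hlt, Ioo_mem_nhdsGT (zero_lt_one' ℝ)] with y h1 h2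
    have h3 := hcubic y (by rw [abs_of_pos h2.1]; exact h2.2.le)
    have h4 := mul_lt_mul_of_pos_right h1 (pow_pos h2.1 2)
    nlinarith
  obtain ⟨s, hs, hneg⟩ : ∃ s, 0 < s ∧ σ2 * s ^ 2 / 2 < Λ (-s) := by
    have hc : Tendsto (fun y : ℝ => -b / 6 - C * y) (𝓝[>] 0) (𝓝 (-b / 6 - C * 0)) :=
      (Continuous.tendsto (by fun_prop) _).mono_left nhdsWithin_le_nhds
    have hlt : 0 < -b / 6 - C * 0 := by simp; linarith
    obtain ⟨s, h1, h2⟩ := ((hc.eventually_const_lt hlt).and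
      (Ioo_mem_nhdsGT (zero_lt_one' ℝ))).exists
    refine ⟨s, h2.1, ?_⟩
    have h3 := hcubic (-s) (by rw [abs_neg, abs_of_pos h2.1]; exact h2.2.le)
    have h4 := mul_pos h1 (pow_pos h2.1 3)
    nlinarith
  obtain ⟨k, w, hw, hlt⟩ := exists_lt_pairSum hσ hs hneg hloc
  let S : Set ℝ := {r | ∃ (k : ℕ) (w : Fin k → ℝ), 0 < ∑ i, w i ^ 2 ∧
    r = pairSum Λ w / (∑ i, w i ^ 2) ^ 2}
  have hub : ∀ r ∈ S, r ≤ c := by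
    rintro r ⟨k, w, hw, rfl⟩
    rw [div_le_iff₀ (by positivity)]
    exact pairSum_le hnn hle w
  have hbdd : BddAbove S := ⟨c, hub⟩
  have hmem : pairSum Λ w / (∑ i, w i ^ 2) ^ 2 ∈ S := ⟨k, w, hw, rfl⟩
  refine ⟨sSup S, ?_, csSup_le ⟨_, hmem⟩ hub, ?_, ?_⟩
  · refine lt_of_lt_of_le ?_ (le_csSup hbdd hmem)
    rwa [lt_div_iff₀ (by positivity)]
  · intro n v
    rcases (Finset.sum_nonneg fun i _ => sq_nonneg (v i) : 0 ≤ ∑ i, v i ^ 2).eq_or_lt with h | h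
    · have := pairSum_le hnn hle v
      rw [← h] at this ⊢
      simpa using this
    · have : pairSum Λ v / (∑ i, v i ^ 2) ^ 2 ≤ sSup S := le_csSup hbdd ⟨n, v, h, rfl⟩
      rwa [div_le_iff₀ (by positivity)] at this
  · intro ε hε
    obtain ⟨r, ⟨k, w, hw, rfl⟩, h⟩ := exists_lt_of_lt_csSup ⟨_, hmem⟩ (sub_lt_self (sSup S) hε)
    refine ⟨k, w, hw, ?_⟩
    rw [lt_div_iff₀ (by positivity)] at h
    exact h.le

/-! ### Nets of the Euclidean sphere. -/

open Metric Module in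
open scoped Function ENNReal in
-- Volume comparison: the balls of radius `ε / 2` about the points are disjoint and lie in the ball
-- of radius `1 + ε / 2`.
theorem card_le_of_separated_unit_ball {E : Type*} [NormedAddCommGroup E] [NormedSpace ℝ E]
    [FiniteDimensional ℝ E] {ε : ℝ} (hε : 0 < ε) (s : Finset E) (hs : ∀ c ∈ s, ‖c‖ ≤ 1)
    (h : ∀ c ∈ s, ∀ d ∈ s, c ≠ d → ε ≤ ‖c - d‖) : (s.card : ℝ) ≤ (1 + 2 / ε) ^ finrank ℝ E := by
  borelize E
  let μ : Measure E := Measure.addHaar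
  obtain ⟨δ, hδ⟩ : ∃ δ, δ = ε / 2 := ⟨_, rfl⟩
  have δpos : 0 < δ := by rw [hδ]; positivity
  have ρpos : 0 < 1 + δ := by positivity
  set A := ⋃ c ∈ s, ball (c : E) δ with hA
  have D : Set.Pairwise (s : Set E) (Disjoint on fun c => ball (c : E) δ) := by
    rintro c hc d hd hcd
    apply ball_disjoint_ball
    rw [dist_eq_norm]
    linarith [h c hc d hd hcd]
  have A_subset : A ⊆ ball (0 : E) (1 + δ) := by
    refine Set.iUnion₂_subset fun x hx => ball_subset_ball' ?_
    rw [dist_zero_right]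
    linarith [hs x hx]
  have I : (s.card : ℝ≥0∞) * ENNReal.ofReal (δ ^ finrank ℝ E) * μ (ball 0 1) ≤
      ENNReal.ofReal ((1 + δ) ^ finrank ℝ E) * μ (ball 0 1) :=
    calc
      (s.card : ℝ≥0∞) * ENNReal.ofReal (δ ^ finrank ℝ E) * μ (ball 0 1) = μ A := by
        rw [hA, measure_biUnion_finset D fun c _ => measurableSet_ball]
        simp only [μ.addHaar_ball_of_pos _ δpos]
        simp only [Finset.sum_const, nsmul_eq_mul, mul_assoc]
      _ ≤ μ (ball (0 : E) (1 + δ)) := measure_mono A_subset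
      _ = ENNReal.ofReal ((1 + δ) ^ finrank ℝ E) * μ (ball 0 1) := by
        simp only [μ.addHaar_ball_of_pos _ ρpos]
  have J := (ENNReal.mul_le_mul_iff_left (measure_ball_pos _ _ zero_lt_one).ne'
    measure_ball_lt_top.ne).1 I
  have K := ENNReal.toReal_le_of_le_ofReal (pow_nonneg ρpos.le _) J
  rw [ENNReal.toReal_mul, ENNReal.toReal_natCast, ENNReal.toReal_ofReal (by positivity)] at K
  have e : 1 + 2 / ε = (1 + δ) / δ := by rw [hδ]; field_simp; ring
  rw [e, div_pow, le_div_iff₀ (by positivity)]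
  exact K

/-- The Euclidean unit sphere has an `ε`-net of cardinality exponential in the dimension. -/
theorem exists_sphere_net (n : ℕ) {ε : ℝ} (hε : 0 < ε) :
    ∃ T : Finset (Fin n → ℝ), (T.card : ℝ) ≤ (1 + 2 / ε) ^ n ∧ (∀ v ∈ T, ∑ i, v i ^ 2 = 1) ∧
      ∀ u : Fin n → ℝ, ∑ i, u i ^ 2 = 1 → ∃ v ∈ T, ∑ i, (u i - v i) ^ 2 ≤ ε ^ 2 := by
  classical
  let S : Set ℕ := {k | ∃ s : Finset (EuclideanSpace ℝ (Fin n)), s.card = k ∧ (∀ c ∈ s, ‖c‖ = 1) ∧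
    ∀ c ∈ s, ∀ d ∈ s, c ≠ d → ε ≤ ‖c - d‖}
  have hcard : ∀ s : Finset (EuclideanSpace ℝ (Fin n)), (∀ c ∈ s, ‖c‖ = 1) →
      (∀ c ∈ s, ∀ d ∈ s, c ≠ d → ε ≤ ‖c - d‖) → (s.card : ℝ) ≤ (1 + 2 / ε) ^ n := by
    intro s h1 h2
    simpa using card_le_of_separated_unit_ball hε s (fun c hc => (h1 c hc).le) h2
  have hbdd : BddAbove S := by
    refine ⟨⌊(1 + 2 / ε) ^ n⌋₊, ?_⟩
    rintro _ ⟨s, rfl, h1, h2⟩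
    exact Nat.le_floor (hcard s h1 h2)
  have hne : S.Nonempty := ⟨0, ∅, by simp⟩
  -- A separated set of maximal cardinality is a net, since a point far from all of it could be
  -- added.
  obtain ⟨s, hs, h1, h2⟩ := Nat.sSup_mem hne hbdd
  have hsq : ∀ x : EuclideanSpace ℝ (Fin n), ∑ i, x i ^ 2 = ‖x‖ ^ 2 := fun x =>
    (EuclideanSpace.real_norm_sq_eq x).symm
  refine ⟨s.image WithLp.ofLp, ?_, ?_, ?_⟩
  · exact le_trans (by exact_mod_cast Finset.card_image_le) (hcard s h1 h2)
  · intro v hv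
    obtain ⟨x, hx, rfl⟩ := Finset.mem_image.1 hv
    rw [hsq, h1 x hx, one_pow]
  · intro u hu
    set x : EuclideanSpace ℝ (Fin n) := WithLp.toLp 2 u
    have hx : ‖x‖ = 1 := by
      have := hsq x
      rw [show ∑ i, x i ^ 2 = 1 from hu] at this
      nlinarith [norm_nonneg x]
    by_cases hclose : ∃ y ∈ s, ‖x - y‖ < ε
    · obtain ⟨y, hy, hlt⟩ := hclose
      refine ⟨_, Finset.mem_image_of_mem _ hy, ?_⟩
      have := hsq (x - y)
      calc ∑ i, (u i - y i) ^ 2 = ‖x - y‖ ^ 2 := this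
        _ ≤ ε ^ 2 := by gcongr
    · push Not at hclose
      have hxs : x ∉ s := fun hx => by
        have := hclose x hx
        simp at this
        linarith
      have hmem : (insert x s).card ∈ S := by
        refine ⟨_, rfl, ?_, ?_⟩
        · intro c hc
          rcases Finset.mem_insert.1 hc with rfl | hc
          · exact hx
          · exact h1 c hc
        · intro c hc d hd hcd
          rcases Finset.mem_insert.1 hc with rfl | hc <;> rcases Finset.mem_insert.1 hd with rfl | hd
          · exact absurd rfl hcd
          · exact hclose d hd
          · rw [norm_sub_rev]; exact hclose c hc
          · exact h2 c hc d hd hcd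
      have := le_csSup hbdd hmem
      rw [Finset.card_insert_of_notMem hxs, hs] at this
      omega

/-! ### The largest eigenvalue and the quadratic form on a net. -/

section QuadraticForm

open Matrix

variable {n : ℕ} {A : Matrix (Fin n) (Fin n) ℝ}

theorem exists_unit_of_lt_lambdaOne {r : ℝ} (hr : 0 ≤ r) (h : r < lambdaOne A) :
    ∃ u : Fin n → ℝ, ∑ i, u i ^ 2 = 1 ∧ r < u ⬝ᵥ A *ᵥ u := by
  -- An empty spectrum would make `lambdaOne A` the default value 0, excluded by `0 ≤ r`.
  have hne : (spectrum ℝ A).Nonempty := by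
    by_contra hne
    rw [Set.not_nonempty_iff_eq_empty] at hne
    rw [lambdaOne, hne, Real.sSup_empty] at h
    linarith
  obtain ⟨μ, hμ, hlt⟩ := exists_lt_of_lt_csSup hne h
  rw [← Matrix.spectrum_toLin', ← Module.End.hasEigenvalue_iff_mem_spectrum] at hμ
  obtain ⟨x, hx⟩ := hμ.exists_hasEigenvector
  have hAx : A *ᵥ x = μ • x := by simpa using hx.apply_eq_smul
  have hpos : 0 < ∑ i, x i ^ 2 := by
    refine (Finset.sum_nonneg fun i _ => sq_nonneg _).lt_of_ne' fun h0 => hx.2 ?_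
    ext i
    simpa using (Finset.sum_eq_zero_iff_of_nonneg fun i _ => sq_nonneg (x i)).1 h0 i
  have hxx : x ⬝ᵥ x = ∑ i, x i ^ 2 := by simp [dotProduct, sq]
  have hs : √(∑ i, x i ^ 2) ^ 2 = ∑ i, x i ^ 2 := Real.sq_sqrt hpos.le
  set q := √(∑ i, x i ^ 2)
  have hq : 0 < q := Real.sqrt_pos.2 hpos
  refine ⟨q⁻¹ • x, ?_, ?_⟩
  · simp only [Pi.smul_apply, smul_eq_mul, mul_pow, ← Finset.mul_sum, ← hs]
    field_simp
  · have : (q⁻¹ • x) ⬝ᵥ A *ᵥ (q⁻¹ • x) = μ := by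
      rw [mulVec_smul, hAx]
      simp only [smul_dotProduct, dotProduct_smul, smul_eq_mul, hxx, ← hs]
      field_simp
    rwa [this]

theorem dotProduct_mulVec_le_lambdaOne (hA : A.IsSymm) {v : Fin n → ℝ} (hv : ∑ i, v i ^ 2 = 1) :
    v ⬝ᵥ A *ᵥ v ≤ lambdaOne A := by
  have hAh : A.IsHermitian := by simpa [Matrix.IsHermitian, Matrix.IsSymm] using hA
  have hT : A.toEuclideanLin.IsSymmetric := isSymmetric_toEuclideanLin_iff.2 hAh
  set x : EuclideanSpace ℝ (Fin n) := WithLp.toLp 2 v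
  have hx : ‖x‖ ^ 2 = 1 := by rw [EuclideanSpace.real_norm_sq_eq]; exact hv
  have hx0 : x ≠ 0 := fun h => by simp [h] at hx
  have : Nontrivial (EuclideanSpace ℝ (Fin n)) := ⟨x, 0, hx0⟩
  have h1 := hT.hasEigenvalue_iSup_of_finiteDimensional
  rw [Module.End.hasEigenvalue_iff_mem_spectrum, toEuclideanLin, spectrum_toLpLin] at h1
  have h2 := le_csSup (A.finite_real_spectrum.bddAbove) h1
  have hb : BddAbove (Set.range fun x : {x : EuclideanSpace ℝ (Fin n) // x ≠ 0} =>
      RCLike.re (inner ℝ (A.toEuclideanLin x) (x : EuclideanSpace ℝ (Fin n))) /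
        ‖(x : EuclideanSpace ℝ (Fin n))‖ ^ 2) := by
    refine ⟨‖A.toEuclideanLin.toContinuousLinearMap‖, ?_⟩
    rintro _ ⟨y, rfl⟩
    have hy : 0 < ‖(y : EuclideanSpace ℝ (Fin n))‖ := norm_pos_iff.2 y.2
    simp only
    rw [div_le_iff₀ (by positivity)]
    refine (re_inner_le_norm _ _).trans ?_
    rw [sq, ← mul_assoc]
    gcongr
    exact A.toEuclideanLin.toContinuousLinearMap.le_opNorm _
  refine le_trans ?_ (le_trans (le_ciSup hb ⟨x, hx0⟩) h2)
  simp only [hx, div_one]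
  apply le_of_eq
  simp [x, EuclideanSpace.inner_eq_star_dotProduct]

theorem Matrix.IsSymm.dotProduct_mulVec_comm (hA : A.IsSymm) (x y : Fin n → ℝ) :
    x ⬝ᵥ A *ᵥ y = y ⬝ᵥ A *ᵥ x := by
  rw [dotProduct_mulVec, ← mulVec_transpose, hA.eq, dotProduct_comm]

/-- The difference is the bilinear form at `x - y` and `x + y`. Rescaling these by `1/√ε` and `√ε`
balances their lengths, and polarization then needs only the bound on the quadratic form. -/
theorem Matrix.IsSymm.abs_quadForm_sub_le (hA : A.IsSymm) {N ε : ℝ} (hε : 0 < ε)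
    (hN : ∀ x, |x ⬝ᵥ A *ᵥ x| ≤ N * ∑ i, x i ^ 2) {x y : Fin n → ℝ} (hx : ∑ i, x i ^ 2 = 1)
    (hy : ∑ i, y i ^ 2 = 1) (hxy : ∑ i, (x i - y i) ^ 2 ≤ ε ^ 2) :
    |x ⬝ᵥ A *ᵥ x - y ⬝ᵥ A *ᵥ y| ≤ 3 * ε * N := by
  have hN0 : 0 ≤ N := by
    have := hN x
    rw [hx, mul_one] at this
    exact (abs_nonneg _).trans this
  obtain ⟨c, hc, hcε⟩ : ∃ c, 0 < c ∧ c ^ 2 = ε := ⟨√ε, Real.sqrt_pos.2 hε, Real.sq_sqrt hε.le⟩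
  set p := c⁻¹ • (x - y) with hp
  set q := c • (x + y) with hq
  have e1 : x ⬝ᵥ A *ᵥ x - y ⬝ᵥ A *ᵥ y = p ⬝ᵥ A *ᵥ q := by
    simp only [hp, hq, mulVec_smul, mulVec_add, smul_dotProduct, dotProduct_smul, sub_dotProduct,
      dotProduct_add, smul_eq_mul]
    rw [hA.dotProduct_mulVec_comm y x]
    field_simp
    ring
  have e2 : 4 * (p ⬝ᵥ A *ᵥ q) = (p + q) ⬝ᵥ A *ᵥ (p + q) - (p - q) ⬝ᵥ A *ᵥ (p - q) := by
    simp only [mulVec_add, mulVec_sub, add_dotProduct, sub_dotProduct, dotProduct_add,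
      dotProduct_sub]
    rw [hA.dotProduct_mulVec_comm q p]
    ring
  have e3 : ∑ i, (p + q) i ^ 2 + ∑ i, (p - q) i ^ 2
      = 2 * (ε⁻¹ * ∑ i, (x i - y i) ^ 2) + 2 * (ε * (4 - ∑ i, (x i - y i) ^ 2)) := by
    have h4 : 4 - ∑ i, (x i - y i) ^ 2 = ∑ i, (x i + y i) ^ 2 := by
      have : ∑ i, (x i + y i) ^ 2 + ∑ i, (x i - y i) ^ 2
          = 2 * ∑ i, x i ^ 2 + 2 * ∑ i, y i ^ 2 := by
        simp only [Finset.mul_sum, ← Finset.sum_add_distrib]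
        exact Finset.sum_congr rfl fun i _ => by ring
      rw [hx, hy] at this
      linarith
    rw [h4, ← hcε]
    simp only [hp, hq, Finset.mul_sum, ← Finset.sum_add_distrib, Pi.add_apply, Pi.sub_apply,
      Pi.smul_apply, smul_eq_mul]
    refine Finset.sum_congr rfl fun i _ => ?_
    field_simp
    ring
  have h1 := abs_le.1 (hN (p + q))
  have h2 := abs_le.1 (hN (p - q))
  have h3 : N * (∑ i, (p + q) i ^ 2 + ∑ i, (p - q) i ^ 2) ≤ N * (10 * ε) := by
    refine mul_le_mul_of_nonneg_left ?_ hN0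
    rw [e3]
    have : ε⁻¹ * ∑ i, (x i - y i) ^ 2 ≤ ε := by
      rw [inv_mul_le_iff₀ hε, ← sq]; exact hxy
    have h0 : 0 ≤ ∑ i, (x i - y i) ^ 2 := Finset.sum_nonneg fun i _ => sq_nonneg _
    nlinarith
  rw [e1, abs_le]
  have : 0 ≤ N * ε := by positivity
  constructor <;> nlinarith [h1.1, h1.2, h2.1, h2.2]

theorem continuous_quadForm (A : Matrix (Fin n) (Fin n) ℝ) :
    Continuous fun x : Fin n → ℝ => x ⬝ᵥ A *ᵥ x := by
  simp only [dotProduct, mulVec]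
  fun_prop

/-- If the quadratic form of a symmetric matrix exceeds `r` somewhere on the unit sphere then on
any fine enough net it nearly exceeds `r`, or is large in absolute value. -/
theorem Matrix.IsSymm.exists_mem_net (hA : A.IsSymm) {r K ε : ℝ} (hε : 0 < ε)
    (hε' : ε ≤ 1 / 6) {T : Finset (Fin n → ℝ)} (hT1 : ∀ v ∈ T, ∑ i, v i ^ 2 = 1)
    (hT2 : ∀ u : Fin n → ℝ, ∑ i, u i ^ 2 = 1 → ∃ v ∈ T, ∑ i, (u i - v i) ^ 2 ≤ ε ^ 2)
    {u : Fin n → ℝ} (hu : ∑ i, u i ^ 2 = 1) (hru : r < u ⬝ᵥ A *ᵥ u) :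
    ∃ v ∈ T, (1 - 3 * ε * K) * r ≤ v ⬝ᵥ A *ᵥ v ∨ K * r / 2 ≤ v ⬝ᵥ A *ᵥ v ∨
      v ⬝ᵥ A *ᵥ v ≤ -(K * r / 2) := by
  have hS : IsCompact {x : Fin n → ℝ | ∑ i, x i ^ 2 = 1} := by
    refine (isCompact_univ_pi (fun _ : Fin n => isCompact_Icc (a := (-1 : ℝ)) (b := 1))).of_isClosed_subset
      (isClosed_eq (by fun_prop) continuous_const) ?_
    intro x hx i _
    have : x i ^ 2 ≤ 1 := by
      rw [← show ∑ i, x i ^ 2 = 1 from hx]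
      exact Finset.single_le_sum (fun i _ => sq_nonneg (x i)) (Finset.mem_univ i)
    exact abs_le.1 ((sq_le_one_iff_abs_le_one _).1 this)
  obtain ⟨u₀, hu₀, hmax⟩ := hS.exists_isMaxOn ⟨u, hu⟩ (continuous_quadForm A).abs.continuousOn
  obtain ⟨N, hN⟩ : ∃ N, N = |u₀ ⬝ᵥ A *ᵥ u₀| := ⟨_, rfl⟩
  have hbound : ∀ x, |x ⬝ᵥ A *ᵥ x| ≤ N * ∑ i, x i ^ 2 := by
    intro x
    rcases (Finset.sum_nonneg fun i _ => sq_nonneg (x i) : 0 ≤ ∑ i, x i ^ 2).eq_or_lt with h | h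
    · have : x = 0 := by
        ext i
        simpa using (Finset.sum_eq_zero_iff_of_nonneg fun i _ => sq_nonneg (x i)).1 h.symm i
      simp [this]
    · have hs : √(∑ i, x i ^ 2) ^ 2 = ∑ i, x i ^ 2 := Real.sq_sqrt h.le
      set q := √(∑ i, x i ^ 2)
      have hq : 0 < q := Real.sqrt_pos.2 h
      have hmem : ∑ i, (q⁻¹ • x) i ^ 2 = 1 := by
        simp only [Pi.smul_apply, smul_eq_mul, mul_pow, ← Finset.mul_sum, ← hs]
        field_simp
      have := hmax hmem
      simp only [Set.mem_ofPred_eq, mulVec_smul, smul_dotProduct, dotProduct_smul, smul_eq_mul,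
        ← hN] at this
      rw [abs_mul, abs_mul, abs_of_pos (inv_pos.2 hq), ← mul_assoc, ← mul_inv,
        inv_mul_le_iff₀ (by positivity)] at this
      rw [← hs]
      linarith
  have hN0 : 0 ≤ N := hN ▸ abs_nonneg _
  -- If the maximum `N` of the absolute form is at most `K * r`, moving to the net loses at most
  -- `3εKr`. Otherwise a net point near the maximizer `u₀` keeps at least `N / 2`.
  rcases le_or_gt N (K * r) with h | h
  · obtain ⟨v, hv, hd⟩ := hT2 u hu
    have := abs_le.1 (hA.abs_quadForm_sub_le hε hbound hu (hT1 v hv) hd)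
    refine ⟨v, hv, Or.inl ?_⟩
    nlinarith [this.2, mul_le_mul_of_nonneg_left h hε.le]
  · obtain ⟨v, hv, hd⟩ := hT2 u₀ hu₀
    have h1 := abs_le.1 (hA.abs_quadForm_sub_le hε hbound hu₀ (hT1 v hv) hd)
    have h2 : 3 * ε * N ≤ N / 2 := by nlinarith
    refine ⟨v, hv, Or.inr ?_⟩
    rcases abs_cases (u₀ ⬝ᵥ A *ᵥ u₀) with h3 | h3
    · left; linarith [h1.1, h1.2, h3.1]
    · right; linarith [h1.1, h1.2, h3.1]

end QuadraticForm

/-! ### Moment generating functions and tails of the quadratic form. -/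

section

open Matrix

variable {Ω₀ : Type*} [MeasurableSpace Ω₀] {P₀ : Measure Ω₀} {ξ : Ω₀ → ℝ} {c : NNReal}
  {Ω : Type*} [MeasurableSpace Ω] {P : Measure Ω} {n : ℕ} {A : Ω → Matrix (Fin n) (Fin n) ℝ}

namespace IsSymmRandomMatrix

theorem quadForm_eq (hA : IsSymmRandomMatrix P₀ ξ P A) (v : Fin n → ℝ) :
    (fun ω => v ⬝ᵥ A ω *ᵥ v) = ∑ p : {p : Fin n × Fin n // p.1 < p.2},
      fun ω => 2 * (v p.1.1 * v p.1.2) * A ω p.1.1 p.1.2 := by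
  ext ω
  rw [Finset.sum_apply]
  have h : v ⬝ᵥ A ω *ᵥ v = ∑ i, ∑ j, v i * A ω i j * v j := by
    simp [dotProduct, mulVec, Finset.mul_sum, mul_assoc]
  rw [h, sum_sum_eq_two_mul_sum_lt fun i j => by rw [(hA.symm ω).apply]; ring]
  simp only [hA.diag_zero, mul_zero, zero_mul, Finset.sum_const_zero, add_zero, Finset.mul_sum]
  exact Finset.sum_congr rfl fun p _ => by ring

theorem aemeasurable_quadForm (hA : IsSymmRandomMatrix P₀ ξ P A) (v : Fin n → ℝ) :
    AEMeasurable (fun ω => v ⬝ᵥ A ω *ᵥ v) P := by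
  rw [hA.quadForm_eq]
  exact Finset.aemeasurable_sum _ fun p _ => (hA.identDistrib _ _ p.2).aemeasurable_fst.const_mul _

variable [IsProbabilityMeasure P₀]

theorem mgf_quadForm (hA : IsSymmRandomMatrix P₀ ξ P A) (hξ : HasSubgaussianMGF ξ c P₀)
    (v : Fin n → ℝ) (s : ℝ) :
    mgf (fun ω => v ⬝ᵥ A ω *ᵥ v) P s = Real.exp (pairSum (fun x => cgf ξ P₀ (s * x)) v) := by
  rw [hA.quadForm_eq, pairSum_eq_sum_lt, Real.exp_sum]
  have hind : iIndepFun (fun (p : {p : Fin n × Fin n // p.1 < p.2}) ω =>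
      2 * (v p.1.1 * v p.1.2) * A ω p.1.1 p.1.2) P := hA.indep.comp (fun p x => 2 * (v p.1.1 * v p.1.2) * x)
    fun p => measurable_const_mul _
  rw [hind.mgf_sum₀ fun p => (hA.identDistrib _ _ p.2).aemeasurable_fst.const_mul _]
  refine Finset.prod_congr rfl fun p _ => ?_
  rw [exp_cgf (hξ.integrable_exp_mul _), ← mgf_congr_identDistrib (hA.identDistrib _ _ p.2),
    mul_comm s]
  exact mgf_const_mul _

theorem integrable_exp_quadForm (hA : IsSymmRandomMatrix P₀ ξ P A) (hξ : HasSubgaussianMGF ξ c P₀)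
    (v : Fin n → ℝ) (s : ℝ) : Integrable (fun ω => Real.exp (s * (v ⬝ᵥ A ω *ᵥ v))) P := by
  -- Without integrability the mgf would be the default value 0, yet `mgf_quadForm` equates it to an
  -- exponential.
  by_contra h
  have h1 := hA.mgf_quadForm hξ v s
  rw [mgf_undef h] at h1
  exact (Real.exp_pos _).ne h1

theorem mgf_quadForm_le (hA : IsSymmRandomMatrix P₀ ξ P A) (hξ : HasSubgaussianMGF ξ c P₀)
    (v : Fin n → ℝ) (s : ℝ) :
    mgf (fun ω => v ⬝ᵥ A ω *ᵥ v) P s ≤ Real.exp (c * s ^ 2 * (∑ i, v i ^ 2) ^ 2) := by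
  rw [hA.mgf_quadForm hξ]
  refine Real.exp_le_exp.2 (pairSum_le (fun x => hξ.cgf_nonneg _) (fun x => ?_) v)
  refine (hξ.cgf_le _).trans (le_of_eq ?_)
  ring

theorem mgf_quadForm_le_of_nonneg (hA : IsSymmRandomMatrix P₀ ξ P A)
    (hξ : HasSubgaussianMGF ξ c P₀) {F : ℝ}
    (hF : ∀ w : Fin n → ℝ, pairSum (cgf ξ P₀) w ≤ F * (∑ i, w i ^ 2) ^ 2)
    (v : Fin n → ℝ) {s : ℝ} (hs : 0 ≤ s) :
    mgf (fun ω => v ⬝ᵥ A ω *ᵥ v) P s ≤ Real.exp (F * s ^ 2 * (∑ i, v i ^ 2) ^ 2) := by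
  rw [hA.mgf_quadForm hξ, pairSum_mul _ _ hs]
  refine Real.exp_le_exp.2 ((hF _).trans (le_of_eq ?_))
  simp only [mul_pow, Real.sq_sqrt hs, ← Finset.mul_sum]
  ring

end IsSymmRandomMatrix

theorem measureReal_ge_le_of_mgf_le [IsProbabilityMeasure P] {X : Ω → ℝ} {F x : ℝ} (hF : 0 < F)
    (hx : 0 ≤ x) (hint : ∀ s, Integrable (fun ω => Real.exp (s * X ω)) P)
    (hmgf : ∀ s, 0 ≤ s → mgf X P s ≤ Real.exp (F * s ^ 2)) :
    P.real {ω | x ≤ X ω} ≤ Real.exp (-(x ^ 2 / (4 * F))) := by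
  -- The minimizer of `F s² - s x`.
  have hs : 0 ≤ x / (2 * F) := by positivity
  refine (measure_ge_le_exp_mul_mgf x hs (hint _)).trans ?_
  refine (mul_le_mul_of_nonneg_left (hmgf _ hs) (Real.exp_pos _).le).trans (le_of_eq ?_)
  rw [← Real.exp_add]
  congr 1
  field_simp
  ring

/-- A lower tail bound for a random variable whose moment generating function is bounded by that
of a Gaussian on the positive half-line, and almost attains this bound at `1`. -/
theorem exp_le_measureReal_ge_of_mgf [IsProbabilityMeasure P] {X : Ω → ℝ} {F S ε κ : ℝ}
    (hF : 0 < F) (hκ0 : 0 ≤ κ) (hκ : κ ≤ 2 * F) (hκε : κ ^ 2 = 8 * F * ε) (hX : AEMeasurable X P)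
    (hint : ∀ s, Integrable (fun ω => Real.exp (s * X ω)) P)
    (hmgf : ∀ s, 0 ≤ s → mgf X P s ≤ Real.exp (F * s ^ 2 * S))
    (hone : Real.exp ((F - ε) * S) ≤ mgf X P 1) (hS : 2 * Real.exp (-(ε * S)) ≤ 1 / 2) :
    1 / 2 * Real.exp (-((F + κ + ε) * S)) ≤ P.real {ω | (2 * F - κ) * S ≤ X ω} := by
  obtain ⟨h, hh⟩ : ∃ h, h = κ / (2 * F) := ⟨_, rfl⟩
  have hh0 : 0 ≤ h := by rw [hh]; positivity
  have hh1 : h ≤ 1 := by rw [hh]; exact div_le_one_of_le₀ hκ (by positivity)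
  have hhF : 2 * F * h = κ := by rw [hh]; field_simp
  have hFh : F * h ^ 2 = 2 * ε := by
    have : F * (F * h ^ 2) = F * (2 * ε) := by
      linear_combination (1 / 4) * hκε + (1 / 4) * (2 * F * h + κ) * hhF
    exact mul_left_cancel₀ hF.ne' this
  set B := {ω | (2 * F - κ) * S ≤ X ω}
  have hB : NullMeasurableSet B P := nullMeasurableSet_le aemeasurable_const hX
  -- Under the tilt by `exp X` the mass sits near `2FS`. The three terms cover the window of
  -- half-width `κS` and its two sides, each side by a Chernoff bound with tilt changed by `h`.
  have hpt : ∀ ω, Real.exp (1 * X ω) ≤ B.indicator (fun _ => Real.exp ((2 * F + κ) * S)) ω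
      + Real.exp (-(h * (2 * F + κ) * S)) * Real.exp ((1 + h) * X ω)
      + Real.exp (h * (2 * F - κ) * S) * Real.exp ((1 - h) * X ω) := by
    intro ω
    rw [← Real.exp_add, ← Real.exp_add]
    have hi : 0 ≤ B.indicator (fun _ => Real.exp ((2 * F + κ) * S)) ω :=
      Set.indicator_nonneg (fun _ _ => (Real.exp_pos _).le) _
    have e1 := Real.exp_pos (-(h * (2 * F + κ) * S) + (1 + h) * X ω)
    have e2 := Real.exp_pos (h * (2 * F - κ) * S + (1 - h) * X ω)
    rcases le_or_gt ((2 * F - κ) * S) (X ω) with h1 | h1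
    · rcases le_or_gt (X ω) ((2 * F + κ) * S) with h2 | h2
      · have : B.indicator (fun _ => Real.exp ((2 * F + κ) * S)) ω = Real.exp ((2 * F + κ) * S) :=
          Set.indicator_of_mem (s := B) h1 _
        rw [this]
        have : Real.exp (1 * X ω) ≤ Real.exp ((2 * F + κ) * S) := Real.exp_le_exp.2 (by linarith)
        linarith
      · have : Real.exp (1 * X ω) ≤ Real.exp (-(h * (2 * F + κ) * S) + (1 + h) * X ω) :=
          Real.exp_le_exp.2 (by nlinarith)
        linarith
    · have : Real.exp (1 * X ω) ≤ Real.exp (h * (2 * F - κ) * S + (1 - h) * X ω) :=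
        Real.exp_le_exp.2 (by nlinarith)
      linarith
  have hiB : Integrable (B.indicator fun _ => Real.exp ((2 * F + κ) * S)) P :=
    (integrable_const _).indicator₀ hB
  have hi1 := (hint (1 + h)).const_mul (Real.exp (-(h * (2 * F + κ) * S)))
  have hi2 := (hint (1 - h)).const_mul (Real.exp (h * (2 * F - κ) * S))
  have hB1 : Integrable (fun ω => B.indicator (fun _ => Real.exp ((2 * F + κ) * S)) ω
      + Real.exp (-(h * (2 * F + κ) * S)) * Real.exp ((1 + h) * X ω)) P := hiB.add hi1
  have hI : mgf X P 1 ≤ P.real B * Real.exp ((2 * F + κ) * S)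
      + Real.exp (-(h * (2 * F + κ) * S)) * mgf X P (1 + h)
      + Real.exp (h * (2 * F - κ) * S) * mgf X P (1 - h) := by
    have := integral_mono (hint 1) (hB1.add hi2) hpt
    rw [integral_add' hB1 hi2, integral_add hiB hi1, integral_const_mul, integral_const_mul,
      integral_indicator₀ hB, setIntegral_const, smul_eq_mul] at this
    exact this
  -- The exponent is `(F - F h²) S` with `F h² = 2ε`, so each side is smaller than the lower bound
  -- in `hone` by the factor `exp (-εS)`; by `hS` the window keeps half.
  have t1 : Real.exp (-(h * (2 * F + κ) * S)) * mgf X P (1 + h) ≤ Real.exp ((F - 2 * ε) * S) := by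
    refine (mul_le_mul_of_nonneg_left (hmgf _ (by linarith)) (Real.exp_pos _).le).trans
      (le_of_eq ?_)
    rw [← Real.exp_add]
    congr 1
    linear_combination (-S) * hFh + S * h * hhF
  have t2 : Real.exp (h * (2 * F - κ) * S) * mgf X P (1 - h) ≤ Real.exp ((F - 2 * ε) * S) := by
    refine (mul_le_mul_of_nonneg_left (hmgf _ (by linarith)) (Real.exp_pos _).le).trans
      (le_of_eq ?_)
    rw [← Real.exp_add]
    congr 1
    linear_combination (-S) * hFh + S * h * hhF
  have e3 : Real.exp ((F - 2 * ε) * S) = Real.exp ((F - ε) * S) * Real.exp (-(ε * S)) := by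
    rw [← Real.exp_add]; congr 1; ring
  have e4 : Real.exp (-((F + κ + ε) * S)) * Real.exp ((2 * F + κ) * S)
      = Real.exp ((F - ε) * S) := by
    rw [← Real.exp_add]; congr 1; ring
  have hpos := Real.exp_pos ((F - ε) * S)
  have hfin : 1 / 2 * Real.exp ((F - ε) * S) ≤ P.real B * Real.exp ((2 * F + κ) * S) := by
    rw [e3] at t1 t2
    nlinarith [mul_le_mul_of_nonneg_left hS hpos.le]
  rw [← e4, ← mul_assoc] at hfin
  exact le_of_mul_le_mul_right hfin (Real.exp_pos _)

namespace IsSymmRandomMatrix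

variable [IsProbabilityMeasure P₀] [IsProbabilityMeasure P]

theorem measureReal_lt_lambdaOne_le (hA : IsSymmRandomMatrix P₀ ξ P A)
    (hξ : HasSubgaussianMGF ξ c P₀) {F r K ε : ℝ} (hF0 : 0 < F) (hc : 0 < c)
    (hF : ∀ w : Fin n → ℝ, pairSum (cgf ξ P₀) w ≤ F * (∑ i, w i ^ 2) ^ 2)
    (hr : 0 ≤ r) (hK : 0 ≤ K) (hKc : 4 * c ≤ F * K ^ 2) (hε : 0 < ε) (hε' : ε ≤ 1 / 6)
    (hεK : 3 * ε * K ≤ 1) :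
    P.real {ω | r < lambdaOne (A ω)}
      ≤ (1 + 2 / ε) ^ n * (3 * Real.exp (-(((1 - 3 * ε * K) * r) ^ 2 / (4 * F)))) := by
  obtain ⟨T, hcard, hT1, hT2⟩ := exists_sphere_net n hε
  set y := Real.exp (-(((1 - 3 * ε * K) * r) ^ 2 / (4 * F)))
  -- `4c ≤ F K²` makes the crude tail at `K r / 2` no larger than the sharp tail.
  have hy : Real.exp (-((K * r / 2) ^ 2 / (4 * c))) ≤ y := by
    have hc' : (0 : ℝ) < c := by exact_mod_cast hc
    have h1 : ((1 - 3 * ε * K) * r) ^ 2 ≤ r ^ 2 := by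
      have h0 : 0 ≤ 3 * ε * K := by positivity
      rw [mul_pow]
      refine mul_le_of_le_one_left (sq_nonneg r) ?_
      nlinarith
    refine Real.exp_le_exp.2 (neg_le_neg ?_)
    rw [div_le_div_iff₀ (by positivity) (by positivity)]
    nlinarith [mul_le_mul_of_nonneg_right hKc (sq_nonneg r)]
  have hv : ∀ v ∈ T, P.real ({ω | (1 - 3 * ε * K) * r ≤ v ⬝ᵥ A ω *ᵥ v} ∪
      ({ω | K * r / 2 ≤ v ⬝ᵥ A ω *ᵥ v} ∪ {ω | K * r / 2 ≤ -(v ⬝ᵥ A ω *ᵥ v)})) ≤ 3 * y := by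
    intro v hvT
    have hv1 := hT1 v hvT
    have hint := hA.integrable_exp_quadForm hξ v
    have p1 : P.real {ω | (1 - 3 * ε * K) * r ≤ v ⬝ᵥ A ω *ᵥ v} ≤ y := by
      refine measureReal_ge_le_of_mgf_le hF0 (mul_nonneg (by linarith) hr) hint fun s hs => ?_
      simpa [hv1] using hA.mgf_quadForm_le_of_nonneg hξ hF v hs
    have p2 : P.real {ω | K * r / 2 ≤ v ⬝ᵥ A ω *ᵥ v} ≤ y := by
      refine (measureReal_ge_le_of_mgf_le (F := c) hc (by positivity) hint fun s hs => ?_).trans hy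
      simpa [hv1] using hA.mgf_quadForm_le hξ v s
    have p3 : P.real {ω | K * r / 2 ≤ -(v ⬝ᵥ A ω *ᵥ v)} ≤ y := by
      refine (measureReal_ge_le_of_mgf_le (F := c) (X := fun ω => -(v ⬝ᵥ A ω *ᵥ v)) hc
        (by positivity) (fun s => ?_) fun s hs => ?_).trans hy
      · simpa using hint (-s)
      · have := hA.mgf_quadForm_le hξ v (-s)
        rw [← mgf_neg] at this
        refine this.trans_eq ?_
        simp [hv1]
    have u1 := measureReal_union_le (μ := P) {ω | (1 - 3 * ε * K) * r ≤ v ⬝ᵥ A ω *ᵥ v}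
      ({ω | K * r / 2 ≤ v ⬝ᵥ A ω *ᵥ v} ∪ {ω | K * r / 2 ≤ -(v ⬝ᵥ A ω *ᵥ v)})
    have u2 := measureReal_union_le (μ := P) {ω | K * r / 2 ≤ v ⬝ᵥ A ω *ᵥ v}
      {ω | K * r / 2 ≤ -(v ⬝ᵥ A ω *ᵥ v)}
    linarith
  have hsub : {ω | r < lambdaOne (A ω)} ⊆ ⋃ v ∈ T, ({ω | (1 - 3 * ε * K) * r ≤ v ⬝ᵥ A ω *ᵥ v} ∪
      ({ω | K * r / 2 ≤ v ⬝ᵥ A ω *ᵥ v} ∪ {ω | K * r / 2 ≤ -(v ⬝ᵥ A ω *ᵥ v)})) := by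
    intro ω hω
    obtain ⟨u, hu, hru⟩ := exists_unit_of_lt_lambdaOne hr hω
    obtain ⟨v, hvT, h⟩ := (hA.symm ω).exists_mem_net (K := K) hε hε' hT1 hT2 hu hru
    refine Set.mem_iUnion₂.2 ⟨v, hvT, ?_⟩
    rcases h with h | h | h
    · exact Or.inl h
    · exact Or.inr (Or.inl h)
    · exact Or.inr (Or.inr (le_neg_of_le_neg h))
  calc P.real {ω | r < lambdaOne (A ω)} ≤ _ := measureReal_mono hsub (measure_ne_top _ _)
    _ ≤ _ := measureReal_biUnion_finset_le _ _
    _ ≤ ∑ v ∈ T, 3 * y := Finset.sum_le_sum hv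
    _ = T.card * (3 * y) := by rw [Finset.sum_const, nsmul_eq_mul]
    _ ≤ _ := mul_le_mul_of_nonneg_right hcard (by positivity)

/-- The tilt is encoded in the length of `u`: with parameter 1 and `‖u‖² = s`, the form is typically
near `2F s²` under the tilt, so the Rayleigh quotient is near `2F s`. -/
theorem le_measureReal_lt_lambdaOne (hA : IsSymmRandomMatrix P₀ ξ P A)
    (hξ : HasSubgaussianMGF ξ c P₀) {F r s ε κ : ℝ} (hF0 : 0 < F)
    (hF : ∀ w : Fin n → ℝ, pairSum (cgf ξ P₀) w ≤ F * (∑ i, w i ^ 2) ^ 2)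
    (hκ0 : 0 ≤ κ) (hκ : κ ≤ 2 * F) (hκε : κ ^ 2 = 8 * F * ε) (hs : 0 < s)
    {u : Fin n → ℝ} (hu : ∑ i, u i ^ 2 = s) (hQ : (F - ε) * s ^ 2 ≤ pairSum (cgf ξ P₀) u)
    (hr : r < (2 * F - κ) * s) (hS : 2 * Real.exp (-(ε * s ^ 2)) ≤ 1 / 2) :
    1 / 2 * Real.exp (-((F + κ + ε) * s ^ 2)) ≤ P.real {ω | r < lambdaOne (A ω)} := by
  refine (exp_le_measureReal_ge_of_mgf hF0 hκ0 hκ hκε (hA.aemeasurable_quadForm u)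
    (hA.integrable_exp_quadForm hξ u) (fun h hh => ?_) ?_ hS).trans
    (measureReal_mono (fun ω hω => ?_) (measure_ne_top _ _))
  · simpa [hu] using hA.mgf_quadForm_le_of_nonneg hξ hF u hh
  · rw [hA.mgf_quadForm hξ]
    simpa using hQ
  · have hq : √s ^ 2 = s := Real.sq_sqrt hs.le
    have hq0 : 0 < √s := Real.sqrt_pos.2 hs
    have h1 := dotProduct_mulVec_le_lambdaOne (hA.symm ω) (v := (√s)⁻¹ • u) (by
      simp only [Pi.smul_apply, smul_eq_mul, mul_pow, ← Finset.mul_sum, hu, inv_pow, hq]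
      field_simp)
    simp only [mulVec_smul, smul_dotProduct, dotProduct_smul, smul_eq_mul] at h1
    rw [← mul_assoc, ← mul_inv, ← sq, hq, inv_mul_le_iff₀ hs] at h1
    have h2 : (2 * F - κ) * s ^ 2 ≤ u ⬝ᵥ A ω *ᵥ u := hω
    have h3 : s * ((2 * F - κ) * s) ≤ s * lambdaOne (A ω) := by linarith
    exact hr.trans_le (le_of_mul_le_mul_left h3 hs)

end IsSymmRandomMatrix

end

/-! ### Asymptotics in `n` and conclusion. -/

theorem tendsto_of_tendsto_div_sqrt {m : ℕ → ℝ}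
    (hm : Tendsto (fun n : ℕ => m n / √(n : ℝ)) atTop atTop) : Tendsto m atTop atTop := by
  have h := hm.atTop_mul_atTop₀ (Real.tendsto_sqrt_atTop.comp tendsto_natCast_atTop_atTop)
  refine h.congr' ?_
  filter_upwards [eventually_gt_atTop 0] with n hn
  have : 0 < √(n : ℝ) := Real.sqrt_pos.2 (by exact_mod_cast hn)
  simp only [Function.comp]
  field_simp

theorem tendsto_natCast_div_sq {m : ℕ → ℝ}
    (hm : Tendsto (fun n : ℕ => m n / √(n : ℝ)) atTop atTop) :
    Tendsto (fun n : ℕ => (n : ℝ) / m n ^ 2) atTop (𝓝 0) := by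
  have h := (hm.atTop_mul_atTop₀ hm).inv_tendsto_atTop
  refine h.congr' ?_
  filter_upwards with n
  simp only [Pi.inv_apply]
  rw [div_mul_div_comm, Real.mul_self_sqrt (Nat.cast_nonneg n), inv_div, sq]

section

variable {Ω₀ : Type*} [MeasurableSpace Ω₀] {P₀ : Measure Ω₀} [IsProbabilityMeasure P₀] {ξ : Ω₀ → ℝ}
  {c : NNReal} {m : ℕ → ℝ} {Ω : ℕ → Type*} [∀ n, MeasurableSpace (Ω n)]
  {P : (n : ℕ) → Measure (Ω n)} [∀ n, IsProbabilityMeasure (P n)]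
  {A : (n : ℕ) → Ω n → Matrix (Fin n) (Fin n) ℝ} {F t : ℝ}

theorem eventually_log_measureReal_lambdaOne_le (hξ : HasSubgaussianMGF ξ c P₀) (hF0 : 0 < F)
    (hFc : F ≤ c)
    (hF : ∀ (n : ℕ) (w : Fin n → ℝ), pairSum (cgf ξ P₀) w ≤ F * (∑ i, w i ^ 2) ^ 2)
    (hm : Tendsto (fun n : ℕ => m n / √(n : ℝ)) atTop atTop)
    (hA : ∀ n, IsSymmRandomMatrix P₀ ξ (P n) (A n)) (ht : 0 < t)
    (hpos : ∀ᶠ n : ℕ in atTop, 0 < (P n).real {ω | lambdaOne (A n ω) > m n * t})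
    {x : ℝ} (hx : -(t ^ 2 / (4 * F)) < x) :
    ∀ᶠ n : ℕ in atTop,
      1 / m n ^ 2 * Real.log ((P n).real {ω | lambdaOne (A n ω) > m n * t}) < x := by
  have hc : (0 : ℝ) < c := hF0.trans_le hFc
  obtain ⟨K, hK, hK2⟩ : ∃ K : ℝ, 0 ≤ K ∧ 4 * c ≤ F * K ^ 2 := by
    refine ⟨√(4 * c / F), Real.sqrt_nonneg _, ?_⟩
    rw [Real.sq_sqrt (by positivity)]
    exact le_of_eq (by field_simp)
  obtain ⟨ε, hε, hε', hεK, hεx⟩ : ∃ ε : ℝ, 0 < ε ∧ ε ≤ 1 / 6 ∧ 3 * ε * K ≤ 1 ∧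
      -(((1 - 3 * ε * K) * t) ^ 2 / (4 * F)) < x := by
    have h1 : Tendsto (fun ε : ℝ => -(((1 - 3 * ε * K) * t) ^ 2 / (4 * F))) (𝓝[>] 0)
        (𝓝 (-(((1 - 3 * 0 * K) * t) ^ 2 / (4 * F)))) :=
      (Continuous.tendsto (by fun_prop) _).mono_left nhdsWithin_le_nhds
    have h2 : Tendsto (fun ε : ℝ => 3 * ε * K) (𝓝[>] 0) (𝓝 (3 * 0 * K)) :=
      (Continuous.tendsto (by fun_prop) _).mono_left nhdsWithin_le_nhds
    obtain ⟨ε, ⟨g1, g2⟩, g3⟩ := ((h1.eventually_lt_const (u := x) (by simpa using hx)).and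
      (h2.eventually_lt_const (u := 1) (by simp))).and
      (Ioo_mem_nhdsGT (by norm_num : (0 : ℝ) < 1 / 6)) |>.exists
    exact ⟨ε, g3.1, g3.2.le, g2.le, g1⟩
  have hmt := tendsto_of_tendsto_div_sqrt hm
  have hsq : Tendsto (fun n => (m n ^ 2)⁻¹) atTop (𝓝 0) :=
    ((tendsto_pow_atTop two_ne_zero).comp hmt).inv_tendsto_atTop
  -- The entropy of the net vanishes after division by `m²`; this uses `m ≫ √n`.
  have hlim : Tendsto (fun n : ℕ => n / m n ^ 2 * Real.log (1 + 2 / ε) + (m n ^ 2)⁻¹ * Real.log 3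
      + -(((1 - 3 * ε * K) * t) ^ 2 / (4 * F))) atTop
      (𝓝 (0 * Real.log (1 + 2 / ε) + 0 * Real.log 3 + -(((1 - 3 * ε * K) * t) ^ 2 / (4 * F)))) :=
    (((tendsto_natCast_div_sq hm).mul_const _).add (hsq.mul_const _)).add_const _
  filter_upwards [hlim.eventually_lt_const (u := x) (by simpa using hεx), hpos,
    hmt.eventually_gt_atTop 0] with n h1 h2 h3
  refine lt_of_le_of_lt ?_ h1
  have hle := (hA n).measureReal_lt_lambdaOne_le hξ hF0 (by exact_mod_cast hc) (hF n)
    (mul_pos h3 ht).le hK hK2 hε hε' hεK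
  have hlog := Real.log_le_log h2 hle
  rw [Real.log_mul (by positivity) (by positivity), Real.log_mul (by positivity) (by positivity),
    Real.log_pow, Real.log_exp] at hlog
  rw [one_div, inv_mul_le_iff₀ (by positivity)]
  refine hlog.trans (le_of_eq ?_)
  field_simp
  ring

theorem eventually_lt_log_measureReal_lambdaOne (hξ : HasSubgaussianMGF ξ c P₀) (hF0 : 0 < F)
    (hF : ∀ (n : ℕ) (w : Fin n → ℝ), pairSum (cgf ξ P₀) w ≤ F * (∑ i, w i ^ 2) ^ 2)
    (hFε : ∀ ε > 0, ∃ (k : ℕ) (w : Fin k → ℝ), 0 < ∑ i, w i ^ 2 ∧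
        (F - ε) * (∑ i, w i ^ 2) ^ 2 ≤ pairSum (cgf ξ P₀) w)
    (hm : Tendsto (fun n : ℕ => m n / √(n : ℝ)) atTop atTop)
    (hm' : Tendsto (fun n : ℕ => m n / (n : ℝ)) atTop (𝓝 0))
    (hA : ∀ n, IsSymmRandomMatrix P₀ ξ (P n) (A n)) (ht : 0 < t)
    {x : ℝ} (hx : x < -(t ^ 2 / (4 * F))) :
    ∀ᶠ n : ℕ in atTop, 0 < (P n).real {ω | lambdaOne (A n ω) > m n * t} ∧
      x < 1 / m n ^ 2 * Real.log ((P n).real {ω | lambdaOne (A n ω) > m n * t}) := by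
  obtain ⟨κ, ε, hκ0, hκ, hε, hκε, hκx⟩ : ∃ κ ε : ℝ, 0 ≤ κ ∧ κ < 2 * F ∧ 0 < ε ∧
      κ ^ 2 = 8 * F * ε ∧ x < -((F + κ + ε) * (t / (2 * F - κ)) ^ 2) := by
    have h1 : Tendsto (fun κ : ℝ => -((F + κ + κ ^ 2 / (8 * F)) * (t / (2 * F - κ)) ^ 2)) (𝓝[>] 0)
        (𝓝 (-((F + 0 + 0 ^ 2 / (8 * F)) * (t / (2 * F - 0)) ^ 2))) := by
      refine Tendsto.mono_left (ContinuousAt.tendsto ?_) nhdsWithin_le_nhds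
      have : 2 * F - 0 ≠ 0 := by simp [hF0.ne']
      fun_prop (disch := assumption)
    have e : -((F + 0 + 0 ^ 2 / (8 * F)) * (t / (2 * F - 0)) ^ 2) = -(t ^ 2 / (4 * F)) := by
      field_simp; ring
    rw [e] at h1
    obtain ⟨κ, g1, g2⟩ := ((h1.eventually_const_lt hx).and
      (Ioo_mem_nhdsGT (by positivity : (0 : ℝ) < 2 * F))).exists
    have g3 : 0 < κ := g2.1
    exact ⟨κ, κ ^ 2 / (8 * F), g3.le, g2.2, by positivity, by field_simp, g1⟩
  obtain ⟨k, w, hw, hwQ⟩ := hFε ε hε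
  set a := ∑ i, w i ^ 2
  have hmt := tendsto_of_tendsto_div_sqrt hm
  have hd : 0 < 2 * F - κ := by linarith
  -- With `L ≈ m q` copies, `(2F - κ) L a` is just above `m t`; the `+ 1` in `L` makes this strict.
  let q : ℝ := t / (2 * F - κ) / a
  have hq : 0 < q := by positivity
  let L : ℕ → ℕ := fun n => ⌊m n * q⌋₊ + 1
  let s : ℕ → ℝ := fun n => L n * a
  have hmq : Tendsto (fun n => m n * q) atTop atTop := hmt.atTop_mul_const hq
  have hLm : Tendsto (fun n => (L n : ℝ) / m n) atTop (𝓝 q) := by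
    have h1 : Tendsto (fun n => q + (m n)⁻¹) atTop (𝓝 (q + 0)) :=
      hmt.inv_tendsto_atTop.const_add q
    rw [add_zero] at h1
    refine tendsto_of_tendsto_of_tendsto_of_le_of_le' tendsto_const_nhds h1 ?_ ?_
    · filter_upwards [hmt.eventually_gt_atTop 0] with n hn
      rw [le_div_iff₀ hn, mul_comm]
      simpa [L] using (Nat.lt_floor_add_one (m n * q)).le
    · filter_upwards [hmt.eventually_gt_atTop 0] with n hn
      rw [div_le_iff₀ hn, add_mul, inv_mul_cancel₀ hn.ne', mul_comm q]
      simpa [L] using Nat.floor_le (by positivity : 0 ≤ m n * q)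
  have hsm : Tendsto (fun n => s n / m n) atTop (𝓝 (t / (2 * F - κ))) := by
    have h1 := hLm.mul_const a
    rw [show q * a = t / (2 * F - κ) from div_mul_cancel₀ _ hw.ne'] at h1
    exact h1.congr fun n => by simp only [s]; ring
  -- Here `m ≪ n` provides room for `L` copies of the `k` coordinates.
  have hkL : ∀ᶠ n : ℕ in atTop, k * L n ≤ n := by
    have h1 := (hLm.mul hm').const_mul (k : ℝ)
    rw [mul_zero, mul_zero] at h1
    filter_upwards [h1.eventually_lt_const (zero_lt_one' ℝ), hmt.eventually_gt_atTop 0,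
      eventually_gt_atTop 0] with n h2 h3 h4
    have h4' : (0 : ℝ) < n := by exact_mod_cast h4
    have h5 : (k : ℝ) * (L n / m n * (m n / n)) = (k * L n : ℕ) / n := by
      push_cast; field_simp
    rw [h5, div_lt_one h4'] at h2
    exact_mod_cast h2.le
  have hrs : ∀ n, m n * t < (2 * F - κ) * s n := by
    intro n
    have h1 : m n * q < L n := by simpa [L] using Nat.lt_floor_add_one (m n * q)
    have h2 : m n * t = (2 * F - κ) * (m n * q * a) := by
      simp only [q]; field_simp
    rw [h2]
    exact mul_lt_mul_of_pos_left (mul_lt_mul_of_pos_right h1 hw) hd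
  have hspos : ∀ n, 0 < s n := fun n => by
    have : (0 : ℝ) < L n := by simp only [L]; positivity
    exact mul_pos this hw
  have hsinf : Tendsto s atTop atTop := by
    refine (hsm.pos_mul_atTop (by positivity) hmt).congr' ?_
    filter_upwards [hmt.eventually_gt_atTop 0] with n hn
    field_simp
  have hexp : ∀ᶠ n in atTop, 2 * Real.exp (-(ε * s n ^ 2)) ≤ 1 / 2 := by
    have h1 : Tendsto (fun n => 2 * Real.exp (-(ε * s n ^ 2))) atTop (𝓝 (2 * 0)) := by
      refine (Real.tendsto_exp_neg_atTop_nhds_zero.comp ?_).const_mul 2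
      exact ((tendsto_pow_atTop two_ne_zero).comp hsinf).const_mul_atTop hε
    filter_upwards [h1.eventually_lt_const (u := 1 / 2) (by norm_num)] with n hn
    exact hn.le
  have hsq : Tendsto (fun n => (m n ^ 2)⁻¹) atTop (𝓝 0) :=
    ((tendsto_pow_atTop two_ne_zero).comp hmt).inv_tendsto_atTop
  have hlim : Tendsto (fun n => (m n ^ 2)⁻¹ * Real.log (1 / 2) + -((F + κ + ε) * (s n / m n) ^ 2))
      atTop (𝓝 (0 * Real.log (1 / 2) + -((F + κ + ε) * (t / (2 * F - κ)) ^ 2))) :=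
    (hsq.mul_const _).add ((hsm.pow 2).const_mul _).neg
  filter_upwards [hkL, hexp, hmt.eventually_gt_atTop 0,
    hlim.eventually_const_lt (u := x) (by simpa using hκx)] with n h1 h2 h3 h4
  have h0 : cgf ξ P₀ 0 = 0 := cgf_zero
  obtain ⟨u, hu, huQ⟩ := exists_replicate h0 hξ.cgf_nonneg w h1
  have hQ : (F - ε) * s n ^ 2 ≤ pairSum (cgf ξ P₀) u := by
    refine le_trans ?_ huQ
    have := mul_le_mul_of_nonneg_left hwQ (sq_nonneg (L n : ℝ))
    refine le_trans (le_of_eq ?_) this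
    simp only [s]; ring
  have hle := (hA n).le_measureReal_lt_lambdaOne hξ hF0 (hF n) hκ0 hκ.le hκε (hspos n) hu hQ
    (hrs n) h2
  refine ⟨lt_of_lt_of_le (by positivity) hle, h4.trans_le ?_⟩
  have hlog := Real.log_le_log (by positivity) hle
  rw [Real.log_mul (by positivity) (by positivity), Real.log_exp] at hlog
  rw [one_div (m n ^ 2), le_inv_mul_iff₀ (by positivity)]
  refine le_trans (le_of_eq ?_) hlog
  field_simp

end

theorem mainTheorem5 {Ω₀ : Type*} [MeasurableSpace Ω₀] (P₀ : Measure Ω₀) [IsProbabilityMeasure P₀]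
    (ξ : Ω₀ → ℝ) (hsub : ∃ c : NNReal, HasSubgaussianMGF ξ c P₀)
    (hthird : ∫ ω, ξ ω ^ 3 ∂P₀ < 0)
    (hcgf : Tendsto (fun s : ℝ => cgf ξ P₀ s / s ^ 2) atTop (𝓝 0)) :
    ∃ η : ℝ, 0 < η ∧
      ∀ (m : ℕ → ℝ), Tendsto (fun n : ℕ => m n / √(n : ℝ)) atTop atTop →
        Tendsto (fun n : ℕ => m n / (n : ℝ)) atTop (𝓝 0) →
      ∀ (Ω : ℕ → Type*) [∀ n, MeasurableSpace (Ω n)]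
        (P : (n : ℕ) → Measure (Ω n)) [∀ n, IsProbabilityMeasure (P n)]
        (A : (n : ℕ) → Ω n → Matrix (Fin n) (Fin n) ℝ),
        (∀ n, IsSymmRandomMatrix P₀ ξ (P n) (A n)) →
      ∀ t : ℝ, 0 < t →
        (∀ᶠ n : ℕ in atTop, 0 < (P n).real {ω | lambdaOne (A n ω) > m n * t}) ∧
        ∃ l : ℝ,
          Tendsto (fun n : ℕ =>
            1 / m n ^ 2 * Real.log ((P n).real {ω | lambdaOne (A n ω) > m n * t}))
            atTop (𝓝 l) ∧
          l > -(1 - η) * (t ^ 2 / (4 * ∫ ω, ξ ω ^ 2 ∂P₀)) := by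
  obtain ⟨c, hξ⟩ := hsub
  -- A vanishing second moment would force `ξ = 0` almost surely, hence a vanishing third moment.
  have hσ : 0 < ∫ ω, ξ ω ^ 2 ∂P₀ := by
    refine (integral_nonneg fun ω => sq_nonneg (ξ ω)).lt_of_ne' fun h0 => hthird.ne ?_
    have h1 := (integral_eq_zero_iff_of_nonneg (fun ω => sq_nonneg (ξ ω)) (hξ.integrable_pow 2)).1 h0
    refine integral_eq_zero_of_ae ?_
    filter_upwards [h1] with ω hω
    have : ξ ω = 0 := by simpa using hω
    simp [this]
  set σ2 := ∫ ω, ξ ω ^ 2 ∂P₀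
  obtain ⟨F, hσF, hFc, hF, hFε⟩ := exists_optimal_constant (Λ := cgf ξ P₀) hξ.cgf_nonneg hξ.cgf_le
    hσ hthird fun s hs => hξ.cubic_le_cgf hs
  have hF0 : 0 < F := hσ.trans hσF
  have hηpos : 0 < (1 - σ2 / F) / 2 := by
    have : σ2 / F < 1 := (div_lt_one hF0).2 hσF
    linarith
  -- With limit `-t² / (4F)`, any `η` in `(0, 1 - σ2 / F)` gives the strict inequality; half of the
  -- gap is taken.
  refine ⟨(1 - σ2 / F) / 2, hηpos, fun m hm hm' Ω _ P _ A hA t ht => ?_⟩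
  have hlow := fun {x : ℝ} (hx : x < -(t ^ 2 / (4 * F))) =>
    eventually_lt_log_measureReal_lambdaOne hξ hF0 hF hFε hm hm' hA ht hx
  have hpos : ∀ᶠ n : ℕ in atTop, 0 < (P n).real {ω | lambdaOne (A n ω) > m n * t} :=
    (hlow (sub_one_lt _)).mono fun n h => h.1
  refine ⟨hpos, -(t ^ 2 / (4 * F)), tendsto_order.2 ⟨fun x hx => (hlow hx).mono fun n h => h.2,
    fun x hx => eventually_log_measureReal_lambdaOne_le hξ hF0 hFc hF hm hA ht hpos hx⟩, ?_⟩
  have e : -(t ^ 2 / (4 * F)) - -(1 - (1 - σ2 / F) / 2) * (t ^ 2 / (4 * σ2))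
      = (1 - σ2 / F) / 2 * (t ^ 2 / (4 * σ2)) := by
    field_simp; ring
  have : 0 < (1 - σ2 / F) / 2 * (t ^ 2 / (4 * σ2)) := mul_pos hηpos (by positivity)
  linarith
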